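/- Let $\mathbb{R}[x_1,\dots,x_n]_{\le 2d}$ be the real vector space of polynomials in $n$ variables of total degree at most $2d$. A linear functional $L:\mathbb{R}[x_1,\dots,x_n]_{\le 2d}\to\mathbb{R}$ is a moment functional if there is a (positive) measure $\mu$ on $\mathbb{R}^n$ such that every $p\in\mathbb{R}[x_1,\dots,x_n]_{\le 2d}$ is $\mu$-integrable and $L(p)=\int p\,\mathrm{d}\mu$. We say that $L$ is a sum of $k$ Gaussian distributions if this holds for some $\mu=\sum_{i=1}^k c_i\cdot N(b_i,S_i)$ with $c_i\ge 0$, $b_i\in\mathbb{R}^n$ and symmetric positive definite $S_i\in\mathbb{R}^{n\times n}$, where $N(b,S)$ is the Gaussian probability measure on $\mathbb{R}^n$ with mean $b$ and covariance matrix $S$. For every integer $d\ge 2$ and every real $\varepsilon>0$ there are an integer $n\ge 1$ and a moment functional $L:\mathbb{R}[x_1,\dots,x_n]_{\le 2d}\to\mathbb{R}$ such that the smallest $k\in\{0,1,2,\dots\}$ for which $L$ is a sum of $k$ Gaussian distributions is \[ \max\left\{0,\left\lceil(1-\varepsilon)\binom{2d+n}{n}\right\rceil\right\}. \] In particular, $L$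 is a sum of that many Gaussian distributions but of no fewer. -/

import Mathlib

open MeasureTheory ProbabilityTheory
open scoped NNReal

/-- The real vector space `ℝ[x₁, …, xₙ]_{≤ m}` of polynomials of total degree at most `m`. -/
abbrev PolyLE (n m : ℕ) : Type :=
  ↥(MvPolynomial.restrictTotalDegree (Fin n) ℝ m)

/-- The (positive) measure `μ` on `ℝⁿ` represents the linear functional `L`:
every polynomial of degree at most `m` is `μ`-integrable and `L p = ∫ p dμ`. -/
def Represents {n m : ℕ} (μ : Measure (EuclideanSpace ℝ (Fin n)))
    (L : PolyLE n m →ₗ[ℝ] ℝ) : Prop :=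
  ∀ p : PolyLE n m,
    Integrable (fun x => MvPolynomial.eval (fun j => x j) (p : MvPolynomial (Fin n) ℝ)) μ ∧
      L p = ∫ x, MvPolynomial.eval (fun j => x j) (p : MvPolynomial (Fin n) ℝ) ∂μ

/-- `L` is a (truncated) moment functional: it has a representing measure on `ℝⁿ`. -/
def IsMomentFunctional {n m : ℕ} (L : PolyLE n m →ₗ[ℝ] ℝ) : Prop :=
  ∃ μ : Measure (EuclideanSpace ℝ (Fin n)), Represents μ L

/-- `L` is represented by a Gaussian mixture `∑ᵢ cᵢ • N(bᵢ, Sᵢ)` with `k` components, where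
`cᵢ ≥ 0`, the means `bᵢ` are arbitrary and the covariance matrices `Sᵢ` are arbitrary
(symmetric) positive definite matrices, so that no component is degenerate. -/
def IsGaussianMixture {n m : ℕ} (L : PolyLE n m →ₗ[ℝ] ℝ) (k : ℕ) : Prop :=
  ∃ (c : Fin k → ℝ≥0) (b : Fin k → EuclideanSpace ℝ (Fin n))
    (S : Fin k → Matrix (Fin n) (Fin n) ℝ),
    (∀ i, (S i).PosDef) ∧ Represents (∑ i, c i • multivariateGaussian (b i) (S i)) L

/-!
The idea is to approximate a sum of `N` point evaluations that needs `N` atoms by a mixture of `N`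
very concentrated Gaussian distributions, and to show that the need for `N` components survives.

Write `d = e + 2`. The polynomial `wellPoly n e` has degree `2 * d`, is nonnegative and vanishes
exactly at the vertices of the cube `{0, 1} ^ n`. If a Gaussian mixture gives it a small mean, then
every component of non-negligible weight is concentrated near the vertex closest to its mean; no
Gaussian distribution can be spread over several vertices
(`integral_sub_roundBit_sq_le`, `integral_sum_sub_vertex_sq_le`). As `wellPoly n e` dominates all
polynomials of degree at most `2 * d`, nothing escapes to infinity either. In quantitative form
(`exists_abs_integral_eval_gaussianMixture_le`): if the means of a mixture `μ` are closest to
vertices in a set `A` and a polynomial `q` of degree at most `2 * d` vanishes on `A`, then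
`|∫ q dμ| ≤ η * μ(ℝⁿ) + C * ∫ wellPoly dμ`, with `C` depending on `q`, `A` and `η > 0` only.

Now take `N` vertices with exactly `2 * d` coordinates equal to `1`. The squarefree monomials of
degree `2 * d` are dual to them, so for each set `A` of fewer than `N` vertices a linear combination
`q_A` of the `N` corresponding monomials vanishes on `A` but not at all the `N` chosen vertices
(`exists_squarefreePoly_vanishing`). Nonnegative weights `w` on the `N` vertices can be chosen such that
`∑ w_i q_A(v_i) ≠ 0` for all `A` simultaneously (`exists_nnreal_forall_sum_mul_ne_zero`). For the
mixture `∑ w_i N(v_i, r² I)` with `r → 0`, the mean of `wellPoly` tends to `0` and the mean of `q_A`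
to `∑ w_i q_A(v_i)`, so by the inequality above no mixture with fewer than `N` components has the
same moments once `r` is small (`exists_isLeast_isGaussianMixture`).

Any `N ≤ n.choose (2 * d)` is possible here, and this binomial coefficient is asymptotically equal
to `(2 * d + n).choose n` as `n → ∞` (`exists_one_sub_mul_choose_le`).
-/

/-! ### Moments of one-dimensional Gaussian distributions -/

lemma integrable_pow_gaussianReal (b : ℝ) (v : ℝ≥0) (k : ℕ) :
    Integrable (fun x => x ^ k) (gaussianReal b v) := by
  have h := (memLp_id_gaussianReal (μ := b) (v := v) k).integrable_norm_pow'
  refine h.mono' (by fun_prop) (Filter.Eventually.of_forall fun x => ?_)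
  simp

/-- The first four moments of the standard Gaussian distribution, read off from the derivatives of
its moment generating function `t ↦ exp (t ^ 2 / 2)` at `0`. -/
lemma integral_pow_gaussianReal_zero_one :
    (∫ x, x ∂gaussianReal 0 1) = 0 ∧ (∫ x, x ^ 2 ∂gaussianReal 0 1) = 1 ∧
      (∫ x, x ^ 3 ∂gaussianReal 0 1) = 0 ∧ (∫ x, x ^ 4 ∂gaussianReal 0 1) = 3 := by
  have key (k : ℕ) : ∫ x, x ^ k ∂gaussianReal 0 1 =
      iteratedDeriv k (fun t : ℝ => Real.exp (t ^ 2 / 2)) 0 := by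
    have h := iteratedDeriv_mgf_zero (X := id) (μ := gaussianReal 0 1)
      (by rw [integrableExpSet_id_gaussianReal]; simp) k
    rw [mgf_id_gaussianReal] at h
    simp only [zero_mul, NNReal.coe_one, one_mul, zero_add] at h
    rw [h]
    rfl
  have he (t : ℝ) : HasDerivAt (fun t : ℝ => Real.exp (t ^ 2 / 2)) (t * Real.exp (t ^ 2 / 2)) t := by
    have := (((hasDerivAt_id t).pow 2).div_const 2).exp
    convert! this using 1
    simp; ring
  have d1 : deriv (fun t : ℝ => Real.exp (t ^ 2 / 2)) = fun t => t * Real.exp (t ^ 2 / 2) :=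
    funext fun t => (he t).deriv
  have d2 : deriv (fun t : ℝ => t * Real.exp (t ^ 2 / 2)) =
      fun t => (1 + t ^ 2) * Real.exp (t ^ 2 / 2) := funext fun t => by
    have := ((hasDerivAt_id t).mul (he t)).deriv
    refine Eq.trans (by rfl) (this.trans ?_)
    simp; ring
  have d3 : deriv (fun t : ℝ => (1 + t ^ 2) * Real.exp (t ^ 2 / 2)) =
      fun t => (3 * t + t ^ 3) * Real.exp (t ^ 2 / 2) := funext fun t => by
    have := ((((hasDerivAt_id t).pow 2).const_add 1).mul (he t)).deriv
    refine Eq.trans (by rfl) (this.trans ?_)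
    simp; ring
  have d4 : deriv (fun t : ℝ => (3 * t + t ^ 3) * Real.exp (t ^ 2 / 2)) =
      fun t => (3 + 6 * t ^ 2 + t ^ 4) * Real.exp (t ^ 2 / 2) := funext fun t => by
    have := ((((hasDerivAt_id t).const_mul 3).add ((hasDerivAt_id t).pow 3)).mul (he t)).deriv
    refine Eq.trans (by rfl) (this.trans ?_)
    simp; ring
  refine ⟨integral_id_gaussianReal, ?_, ?_, ?_⟩ <;> rw [key] <;>
    simp [iteratedDeriv_succ, d1, d2, d3, d4]

lemma integral_quartic_gaussianReal (b : ℝ) (v : ℝ≥0) (c₀ c₁ c₂ c₃ c₄ : ℝ) :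
    ∫ x, (c₀ + c₁ * (x - b) + c₂ * (x - b) ^ 2 + c₃ * (x - b) ^ 3 + c₄ * (x - b) ^ 4)
      ∂gaussianReal b v = c₀ + c₂ * v + 3 * c₄ * v ^ 2 := by
  obtain ⟨m1, m2, m3, m4⟩ := integral_pow_gaussianReal_zero_one
  have hmap : gaussianReal b v = (gaussianReal 0 1).map (fun x => b + √v * x) := by
    have h := gaussianReal_map_const_mul (μ := 0) (v := 1) (√(v : ℝ))
    have h2 := gaussianReal_map_const_add (μ := 0) (v := v) b
    have hv : NNReal.mk (√(v : ℝ) ^ 2) (sq_nonneg _) * 1 = v := by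
      ext; simp
    rw [hv, mul_zero] at h
    rw [← h, Measure.map_map (by fun_prop) (by fun_prop), zero_add] at h2
    rw [← h2]; rfl
  rw [hmap, integral_map (by fun_prop) (by fun_prop)]
  have hs : √(v : ℝ) ^ 2 = v := Real.sq_sqrt v.2
  have hi (k : ℕ) (c : ℝ) : Integrable (fun x : ℝ => c * x ^ k) (gaussianReal 0 1) :=
    (integrable_pow_gaussianReal 0 1 k).const_mul c
  have hi1 (c : ℝ) : Integrable (fun x : ℝ => c * x) (gaussianReal 0 1) := by
    simpa using hi 1 c
  have hc : ∀ x : ℝ, c₀ + c₁ * (b + √v * x - b) + c₂ * (b + √v * x - b) ^ 2 +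
      c₃ * (b + √v * x - b) ^ 3 + c₄ * (b + √v * x - b) ^ 4 =
      c₀ + (c₁ * √v) * x + (c₂ * v) * x ^ 2 + (c₃ * √v ^ 3) * x ^ 3 + (c₄ * v ^ 2) * x ^ 4 := by
    intro x
    linear_combination (c₂ * x ^ 2 + c₄ * x ^ 4 * (√(v : ℝ) ^ 2 + v)) * hs
  simp_rw [hc]
  have i1 : Integrable (fun x : ℝ => c₀ + (c₁ * √v) * x) (gaussianReal 0 1) :=
    (integrable_const _).add (hi1 _)
  have i2 : Integrable (fun x : ℝ => c₀ + (c₁ * √v) * x + (c₂ * v) * x ^ 2) (gaussianReal 0 1) :=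
    i1.add (hi 2 _)
  have i3 : Integrable (fun x : ℝ => c₀ + (c₁ * √v) * x + (c₂ * v) * x ^ 2 + (c₃ * √v ^ 3) * x ^ 3)
      (gaussianReal 0 1) := i2.add (hi 3 _)
  rw [integral_add i3 (hi 4 _), integral_add i2 (hi 3 _), integral_add i1 (hi 2 _),
    integral_add (integrable_const _) (hi1 _)]
  have j1 : ∫ x, c₁ * √v * x ∂gaussianReal 0 1 = 0 := by
    rw [integral_const_mul (c₁ * √v) (fun x => x), m1, mul_zero]
  simp only [integral_const_mul, j1, m2, m3, m4]
  simp
  ring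

/-- The point of `{0, 1}` closest to `b`, with the tie at `1 / 2` resolved to `0`. -/
noncomputable def roundBit (b : ℝ) : ℝ := if 1 / 2 < b then 1 else 0

/-- A Gaussian distribution for which the double well `(x² - x)²` has a small mean is concentrated
near a single one of the two wells: it cannot be spread over both of them. This is where the value
`3 v ^ 2` of the fourth central moment matters, as a symmetric two-point distribution on `{0, 1}`
has a vanishing mean of `(x² - x)²`. -/
lemma integral_sub_roundBit_sq_le (b : ℝ) (v : ℝ≥0) :
    ∫ x, (x - roundBit b) ^ 2 ∂gaussianReal b v ≤
      60 * ∫ x, (x ^ 2 - x) ^ 2 ∂gaussianReal b v := by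
  set a := roundBit b with ha
  set u := b ^ 2 - b with hu
  have e1 : ∫ x, (x - a) ^ 2 ∂gaussianReal b v = (b - a) ^ 2 + v := by
    have := integral_quartic_gaussianReal b v ((b - a) ^ 2) (2 * (b - a)) 1 0 0
    refine Eq.trans (integral_congr_ae (.of_forall fun x => ?_)) (this.trans ?_) <;> ring
  have e2 : ∫ x, (x ^ 2 - x) ^ 2 ∂gaussianReal b v = u ^ 2 + 6 * u * v + v + 3 * v ^ 2 := by
    have := integral_quartic_gaussianReal b v (u ^ 2) (2 * u * (2 * b - 1))
      ((2 * b - 1) ^ 2 + 2 * u) (2 * (2 * b - 1)) 1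
    refine Eq.trans (integral_congr_ae (.of_forall fun x => ?_)) (this.trans ?_) <;>
      simp only [hu] <;> ring
  rw [e1, e2]
  have hs : (0 : ℝ) ≤ v := v.2
  generalize (v : ℝ) = s at hs
  have hu4 : 0 ≤ 1 + 4 * u := by rw [hu]; nlinarith [sq_nonneg (2 * b - 1)]
  have hba : (b - a) ^ 2 ≤ 4 * u ^ 2 := by
    rw [hu, ha, roundBit]
    split_ifs with h
    · have : (1 : ℝ) ≤ 4 * b ^ 2 := by nlinarith
      nlinarith [mul_nonneg (sub_nonneg.2 this) (sq_nonneg (b - 1))]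
    · have : (1 : ℝ) ≤ 4 * (b - 1) ^ 2 := by nlinarith
      nlinarith [mul_nonneg (sub_nonneg.2 this) (sq_nonneg b)]
  set q := u ^ 2 + 6 * u * s + s + 3 * s ^ 2 with hq
  -- The mean `q` of the double well equals `(u + s) ^ 2 + (1 + 4 * u) * s + 2 * s ^ 2`, a sum of
  -- nonnegative terms; `u ^ 2` controls the distance of `b` to the nearer well. The variance `s` is
  -- controlled linearly if `1 + 4 * u` is not small, and `q` is bounded below otherwise.
  have hq0 : 2 * u ^ 2 ≤ 3 * q := by
    rw [hq]; nlinarith [mul_nonneg hu4 hs, sq_nonneg (u + 3 * s)]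
  have hq1 : 2 * s ^ 2 ≤ q := by
    rw [hq]; nlinarith [mul_nonneg hu4 hs, sq_nonneg (u + s)]
  have hsq : s ≤ 54 * q := by
    by_cases h : -1 / 8 ≤ u
    · have : s * (1 + 4 * u) ≤ q := by rw [hq]; nlinarith [sq_nonneg (u + s), sq_nonneg s]
      nlinarith
    · nlinarith [sq_nonneg (s - 1)]
  linarith

/-! ### Polynomials on Euclidean space and their Gaussian integrals -/

section growth

variable {n : ℕ}

lemma continuous_eval_euclidean (q : MvPolynomial (Fin n) ℝ) :
    Continuous fun x : EuclideanSpace ℝ (Fin n) => MvPolynomial.eval (fun j => x j) q :=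
  (MvPolynomial.continuous_eval q).comp (by fun_prop)

lemma exists_abs_eval_le_one_add_norm_pow (q : MvPolynomial (Fin n) ℝ) :
    ∃ (C : ℝ) (m : ℕ), 0 ≤ C ∧ ∀ x : EuclideanSpace ℝ (Fin n),
      |MvPolynomial.eval (fun j => x j) q| ≤ C * (1 + ‖x‖) ^ m := by
  induction q using MvPolynomial.induction_on with
  | C a => exact ⟨|a|, 0, abs_nonneg a, fun x => by simp⟩
  | add p q hp hq =>
    obtain ⟨C, k, hC, hp⟩ := hp
    obtain ⟨D, l, hD, hq⟩ := hq
    refine ⟨C + D, max k l, by positivity, fun x => ?_⟩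
    have h1 : (1 : ℝ) ≤ 1 + ‖x‖ := by linarith [norm_nonneg x]
    rw [map_add, add_mul]
    refine (abs_add_le _ _).trans (add_le_add ((hp x).trans ?_) ((hq x).trans ?_)) <;> gcongr
    · exact le_max_left _ _
    · exact le_max_right _ _
  | mul_X p i hp =>
    obtain ⟨C, k, hC, hp⟩ := hp
    refine ⟨C, k + 1, hC, fun x => ?_⟩
    rw [map_mul, MvPolynomial.eval_X, abs_mul, pow_succ, ← mul_assoc]
    have : |x i| ≤ 1 + ‖x‖ := by
      have := PiLp.norm_apply_le x i
      rw [Real.norm_eq_abs] at this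
      linarith
    exact mul_le_mul (hp x) this (abs_nonneg _) (by positivity)

lemma integrable_add_norm_pow_of_isGaussian (μ : Measure (EuclideanSpace ℝ (Fin n))) [IsGaussian μ]
    (R : ℝ) (m : ℕ) : Integrable (fun x => (R + ‖x‖) ^ m) μ := by
  have h : MemLp (fun x : EuclideanSpace ℝ (Fin n) => R + ‖x‖) m μ :=
    (memLp_const R).add (IsGaussian.memLp_id μ m (by simp)).norm
  refine h.integrable_norm_pow'.mono' (by fun_prop) (Filter.Eventually.of_forall fun x => ?_)
  simp

lemma integrable_eval_of_isGaussian (μ : Measure (EuclideanSpace ℝ (Fin n))) [IsGaussian μ]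
    (q : MvPolynomial (Fin n) ℝ) :
    Integrable (fun x => MvPolynomial.eval (fun j => x j) q) μ := by
  obtain ⟨C, m, -, h⟩ := exists_abs_eval_le_one_add_norm_pow q
  exact ((integrable_add_norm_pow_of_isGaussian μ 1 m).const_mul C).mono'
    (continuous_eval_euclidean q).aestronglyMeasurable (Filter.Eventually.of_forall h)

open scoped MatrixOrder in
lemma multivariateGaussian_sq_smul_one (z : EuclideanSpace ℝ (Fin n)) {r : ℝ} (hr : 0 ≤ r) :
    multivariateGaussian z (r ^ 2 • (1 : Matrix (Fin n) (Fin n) ℝ)) =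
      (stdGaussian (EuclideanSpace ℝ (Fin n))).map (fun x => z + r • x) := by
  have h : CFC.sqrt (r ^ 2 • (1 : Matrix (Fin n) (Fin n) ℝ)) = r • 1 := by
    refine CFC.sqrt_unique ?_ ?_
    · simp [smul_smul, pow_two]
    · exact (Matrix.PosSemidef.one.smul hr).nonneg
  rw [multivariateGaussian, h]
  simp

/-- As an isotropic Gaussian distribution shrinks to its mean `z`, the mean of a polynomial
converges to its value at `z`. -/
lemma tendsto_integral_eval_multivariateGaussian (z : EuclideanSpace ℝ (Fin n))
    (q : MvPolynomial (Fin n) ℝ) :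
    Filter.Tendsto (fun r : ℝ => ∫ x, MvPolynomial.eval (fun j => x j) q
        ∂multivariateGaussian z (r ^ 2 • (1 : Matrix (Fin n) (Fin n) ℝ)))
      (nhdsWithin 0 (Set.Ioi 0)) (nhds (MvPolynomial.eval (fun j => z j) q)) := by
  obtain ⟨C, m, hC, hq⟩ := exists_abs_eval_le_one_add_norm_pow q
  have hcont := continuous_eval_euclidean q
  have hEq : ∀ᶠ r : ℝ in nhdsWithin 0 (Set.Ioi 0),
      ∫ x, MvPolynomial.eval (fun j => (z + r • x) j) q ∂stdGaussian (EuclideanSpace ℝ (Fin n)) =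
      ∫ x, MvPolynomial.eval (fun j => x j) q
        ∂multivariateGaussian z (r ^ 2 • (1 : Matrix (Fin n) (Fin n) ℝ)) := by
    filter_upwards [self_mem_nhdsWithin] with r hr
    rw [multivariateGaussian_sq_smul_one z (le_of_lt hr),
      integral_map (by fun_prop) hcont.aestronglyMeasurable]
  refine Filter.Tendsto.congr' hEq ?_
  have hlim : ∫ x, MvPolynomial.eval (fun j => z j) q ∂stdGaussian (EuclideanSpace ℝ (Fin n)) =
      MvPolynomial.eval (fun j => z j) q := by simp
  rw [← hlim]
  refine tendsto_integral_filter_of_dominated_convergence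
    (fun x => C * ((1 + ‖z‖) + ‖x‖) ^ m) (.of_forall fun r => ?_) ?_
    ((integrable_add_norm_pow_of_isGaussian _ _ _).const_mul C) (.of_forall fun x => ?_)
  · exact (hcont.comp (by fun_prop)).aestronglyMeasurable
  · filter_upwards [Ioc_mem_nhdsGT (zero_lt_one' ℝ)] with r hr
    refine .of_forall fun x => (hq _).trans ?_
    gcongr C * ?_ ^ m
    have h1 : ‖z + r • x‖ ≤ ‖z‖ + ‖r • x‖ := norm_add_le _ _
    have h2 : ‖r • x‖ ≤ ‖x‖ := by
      rw [norm_smul, Real.norm_of_nonneg hr.1.le]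
      exact mul_le_of_le_one_left (norm_nonneg _) hr.2
    linarith
  · have hc : Continuous fun r : ℝ => MvPolynomial.eval (fun j => (z + r • x) j) q :=
      hcont.comp (by fun_prop : Continuous fun r : ℝ => z + r • x)
    have h0 := hc.tendsto 0
    simp only [zero_smul, add_zero] at h0
    exact h0.mono_left nhdsWithin_le_nhds

end growth

/-! ### The multi-well polynomial of the cube -/

section well

variable {n : ℕ}

/-- The vertex of the cube `{0, 1} ^ n` with support `s`. -/
noncomputable def vertex (s : Finset (Fin n)) : EuclideanSpace ℝ (Fin n) :=
  WithLp.toLp 2 fun j => if j ∈ s then 1 else 0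

@[simp]
lemma vertex_apply (s : Finset (Fin n)) (j : Fin n) : vertex s j = if j ∈ s then 1 else 0 := rfl

/-- The support of the vertex of the cube `{0, 1} ^ n` closest to `b`, with ties resolved to `0`. -/
noncomputable def roundSupport (b : EuclideanSpace ℝ (Fin n)) : Finset (Fin n) :=
  Finset.univ.filter fun j => 1 / 2 < b j

lemma vertex_roundSupport_apply (b : EuclideanSpace ℝ (Fin n)) (j : Fin n) :
    vertex (roundSupport b) j = roundBit (b j) := by
  simp [roundSupport, roundBit]

/-- A nonnegative polynomial of degree `2 * (e + 2)` on `ℝⁿ` that vanishes exactly at the vertices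
of the cube `{0, 1} ^ n`. The factor `1 + X ^ (2 * e)` makes it grow like `∑ x_j ^ (2 * (e + 2))`
at infinity. -/
noncomputable def wellPoly (n e : ℕ) : MvPolynomial (Fin n) ℝ :=
  ∑ j, (MvPolynomial.X j ^ 2 - MvPolynomial.X j) ^ 2 * (1 + MvPolynomial.X j ^ (2 * e))

lemma eval_wellPoly (e : ℕ) (x : Fin n → ℝ) :
    MvPolynomial.eval x (wellPoly n e) = ∑ j, (x j ^ 2 - x j) ^ 2 * (1 + x j ^ (2 * e)) := by
  simp [wellPoly]

lemma eval_wellPoly_nonneg (e : ℕ) (x : Fin n → ℝ) :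
    0 ≤ MvPolynomial.eval x (wellPoly n e) := by
  rw [eval_wellPoly]
  refine Finset.sum_nonneg fun j _ => mul_nonneg (sq_nonneg _) ?_
  have := (even_two_mul e).pow_nonneg (x j)
  linarith

lemma eval_wellPoly_vertex (e : ℕ) (s : Finset (Fin n)) :
    MvPolynomial.eval (fun j => vertex s j) (wellPoly n e) = 0 := by
  rw [eval_wellPoly]
  refine Finset.sum_eq_zero fun j _ => ?_
  by_cases h : j ∈ s <;> simp [h]

lemma wellPoly_mem (n e : ℕ) :
    wellPoly n e ∈ MvPolynomial.restrictTotalDegree (Fin n) ℝ (2 * (e + 2)) := by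
  rw [MvPolynomial.mem_restrictTotalDegree]
  refine MvPolynomial.totalDegree_finsetSum_le fun j _ => ?_
  have h1 : (MvPolynomial.X j ^ 2 - MvPolynomial.X j : MvPolynomial (Fin n) ℝ).totalDegree ≤ 2 :=
    (MvPolynomial.totalDegree_sub _ _).trans (by simp)
  have h2 : (1 + MvPolynomial.X j ^ (2 * e) : MvPolynomial (Fin n) ℝ).totalDegree ≤ 2 * e :=
    (MvPolynomial.totalDegree_add _ _).trans (by simp)
  have h3 := MvPolynomial.totalDegree_pow
    (MvPolynomial.X j ^ 2 - MvPolynomial.X j : MvPolynomial (Fin n) ℝ) 2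
  refine (MvPolynomial.totalDegree_mul _ _).trans ?_
  omega

lemma sum_sq_le_eval_wellPoly (e : ℕ) (x : Fin n → ℝ) :
    ∑ j, (x j ^ 2 - x j) ^ 2 ≤ MvPolynomial.eval x (wellPoly n e) := by
  rw [eval_wellPoly]
  refine Finset.sum_le_sum fun j _ => le_mul_of_one_le_right (sq_nonneg _) ?_
  have := (even_two_mul e).pow_nonneg (x j)
  linarith

lemma pow_le_add_well (e : ℕ) (y : ℝ) :
    y ^ (2 * (e + 2)) ≤ 4 ^ (e + 2) + 4 * ((y ^ 2 - y) ^ 2 * (1 + y ^ (2 * e))) := by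
  have h0 : 0 ≤ y ^ (2 * e) := (even_two_mul e).pow_nonneg y
  rcases le_total (y ^ 2) 4 with h | h
  · have : y ^ (2 * (e + 2)) ≤ 4 ^ (e + 2) := by
      rw [pow_mul]; exact pow_le_pow_left₀ (sq_nonneg y) h _
    have : 0 ≤ (y ^ 2 - y) ^ 2 * (1 + y ^ (2 * e)) := by positivity
    linarith
  · have h1 : y ^ 2 ≤ 4 * (y - 1) ^ 2 := by
      rcases le_total y 0 with hy | hy <;> nlinarith
    have h2 : y ^ (2 * (e + 2)) ≤ 4 * ((y ^ 2 - y) ^ 2 * y ^ (2 * e)) := by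
      have := mul_le_mul_of_nonneg_left h1 (mul_nonneg h0 (sq_nonneg y))
      calc y ^ (2 * (e + 2)) = y ^ (2 * e) * y ^ 2 * y ^ 2 := by ring
        _ ≤ _ := this
        _ = _ := by ring
    have : (0 : ℝ) ≤ 4 ^ (e + 2) := by positivity
    nlinarith [sq_nonneg (y ^ 2 - y)]

lemma abs_prod_pow_le (x : Fin n → ℝ) (k : ℕ) (α : Fin n →₀ ℕ) (hα : ∑ j, α j ≤ 2 * k) :
    |∏ j, x j ^ α j| ≤ 1 + ∑ j, x j ^ (2 * k) := by
  have hnn : ∀ j, 0 ≤ x j ^ (2 * k) := fun j => (even_two_mul k).pow_nonneg _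
  rw [Finset.abs_prod]
  by_cases h : ∀ j, |x j| ≤ 1
  · have : ∏ j, |x j ^ α j| ≤ 1 := Finset.prod_le_one (fun _ _ => abs_nonneg _) fun j _ => by
      rw [abs_pow]; exact pow_le_one₀ (abs_nonneg _) (h j)
    linarith [Finset.sum_nonneg fun j (_ : j ∈ Finset.univ) => hnn j]
  · push Not at h
    obtain ⟨j₀, hj₀⟩ := h
    obtain ⟨i, -, hi⟩ := Finset.exists_max_image Finset.univ (fun j => |x j|) ⟨j₀, by simp⟩
    have h1 : 1 ≤ |x i| := hj₀.le.trans (hi j₀ (by simp))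
    calc ∏ j, |x j ^ α j| ≤ ∏ j, |x i| ^ α j :=
          Finset.prod_le_prod (fun _ _ => abs_nonneg _) fun j _ => by
            rw [abs_pow]; exact pow_le_pow_left₀ (abs_nonneg _) (hi j (by simp)) _
      _ = |x i| ^ ∑ j, α j := Finset.prod_pow_eq_pow_sum _ _ _
      _ ≤ |x i| ^ (2 * k) := pow_le_pow_right₀ h1 hα
      _ = x i ^ (2 * k) := (even_two_mul k).pow_abs _
      _ ≤ ∑ j, x j ^ (2 * k) :=
          Finset.single_le_sum (f := fun j => x j ^ (2 * k)) (fun j _ => hnn j) (Finset.mem_univ i)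
      _ ≤ _ := by linarith

/-- The multi-well polynomial dominates all polynomials of degree at most `2 * (e + 2)`. -/
lemma exists_abs_eval_le_wellPoly (e : ℕ) (q : MvPolynomial (Fin n) ℝ)
    (hq : q ∈ MvPolynomial.restrictTotalDegree (Fin n) ℝ (2 * (e + 2))) :
    ∃ C : ℝ, 0 ≤ C ∧ ∀ x : Fin n → ℝ,
      |MvPolynomial.eval x q| ≤ C * (1 + MvPolynomial.eval x (wellPoly n e)) := by
  rw [MvPolynomial.mem_restrictTotalDegree] at hq
  set D : ℝ := ∑ α ∈ q.support, |q.coeff α| with hD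
  have hD0 : 0 ≤ D := Finset.sum_nonneg fun _ _ => abs_nonneg _
  set B : ℝ := 4 + n * 4 ^ (e + 2) with hB
  refine ⟨D * B, by positivity, fun x => ?_⟩
  have hP := eval_wellPoly_nonneg e x
  have h1 : |MvPolynomial.eval x q| ≤ D * (1 + ∑ j, x j ^ (2 * (e + 2))) := by
    rw [MvPolynomial.eval_eq', hD, Finset.sum_mul]
    refine (Finset.abs_sum_le_sum_abs _ _).trans (Finset.sum_le_sum fun α hα => ?_)
    rw [abs_mul]
    refine mul_le_mul_of_nonneg_left (abs_prod_pow_le x (e + 2) α ?_) (abs_nonneg _)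
    have := (MvPolynomial.le_totalDegree hα).trans hq
    rwa [Finsupp.sum_fintype _ _ (fun _ => rfl)] at this
  have h2 : ∑ j, x j ^ (2 * (e + 2)) ≤
      n * 4 ^ (e + 2) + 4 * MvPolynomial.eval x (wellPoly n e) := by
    rw [eval_wellPoly, Finset.mul_sum]
    calc ∑ j, x j ^ (2 * (e + 2)) ≤
        ∑ j, (4 ^ (e + 2) + 4 * ((x j ^ 2 - x j) ^ 2 * (1 + x j ^ (2 * e)))) :=
          Finset.sum_le_sum fun j _ => pow_le_add_well e (x j)
      _ = _ := by rw [Finset.sum_add_distrib]; simp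
  refine h1.trans ?_
  rw [mul_assoc]
  refine mul_le_mul_of_nonneg_left ?_ hD0
  have h3 : (0 : ℝ) ≤ n * 4 ^ (e + 2) := by positivity
  rw [hB]
  nlinarith

/-- A polynomial of degree at most `2 * (e + 2)` vanishing at a vertex is controlled, up to an
arbitrarily small constant, by the squared distance to that vertex and the multi-well
polynomial. -/
lemma exists_abs_eval_le_of_eval_vertex_eq_zero (e : ℕ) (q : MvPolynomial (Fin n) ℝ)
    (hq : q ∈ MvPolynomial.restrictTotalDegree (Fin n) ℝ (2 * (e + 2))) (s : Finset (Fin n))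
    (hs : MvPolynomial.eval (fun j => vertex s j) q = 0) {η : ℝ} (hη : 0 < η) :
    ∃ C : ℝ, 0 ≤ C ∧ ∀ x : EuclideanSpace ℝ (Fin n), |MvPolynomial.eval (fun j => x j) q| ≤
      η + C * (∑ j, (x j - vertex s j) ^ 2 + MvPolynomial.eval (fun j => x j) (wellPoly n e)) := by
  obtain ⟨B, hB, hle⟩ := exists_abs_eval_le_wellPoly e q hq
  obtain ⟨ρ, hρ, hball⟩ := Metric.continuous_iff.1 (continuous_eval_euclidean q) (vertex s) η hη
  refine ⟨B / ρ ^ 2 + B, by positivity, fun x => ?_⟩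
  have hP := eval_wellPoly_nonneg e (fun j => x j)
  have hS : ∑ j, (x j - vertex s j) ^ 2 = dist x (vertex s) ^ 2 := by
    rw [EuclideanSpace.dist_eq, Real.sq_sqrt (Finset.sum_nonneg fun _ _ => sq_nonneg _)]
    simp [Real.dist_eq]
  rw [hS]
  by_cases h : dist x (vertex s) < ρ
  · have h1 := hball x h
    rw [hs, Real.dist_eq, sub_zero] at h1
    have : 0 ≤ (B / ρ ^ 2 + B) * (dist x (vertex s) ^ 2 +
      MvPolynomial.eval (fun j => x j) (wellPoly n e)) := by positivity
    linarith
  · push Not at h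
    have h1 : B ≤ B / ρ ^ 2 * dist x (vertex s) ^ 2 := by
      rw [div_mul_eq_mul_div, le_div_iff₀ (by positivity)]
      gcongr
    have h2 : 0 ≤ B / ρ ^ 2 * MvPolynomial.eval (fun j => x j) (wellPoly n e) := by positivity
    have h3 : 0 ≤ B * dist x (vertex s) ^ 2 := by positivity
    have := hle (fun j => x j)
    nlinarith

/-- For a Gaussian distribution, the mean squared distance to the vertex closest to its mean is
controlled by the mean of the multi-well polynomial. -/
lemma integral_sum_sub_vertex_sq_le (e : ℕ) (b : EuclideanSpace ℝ (Fin n))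
    {S : Matrix (Fin n) (Fin n) ℝ} (hS : S.PosDef) :
    ∫ x, ∑ j, (x j - vertex (roundSupport b) j) ^ 2 ∂multivariateGaussian b S ≤
      60 * ∫ x, MvPolynomial.eval (fun j => x j) (wellPoly n e) ∂multivariateGaussian b S := by
  have hint (q : MvPolynomial (Fin n) ℝ) := integrable_eval_of_isGaussian
    (multivariateGaussian b S) q
  have i1 (j : Fin n) : Integrable (fun x : EuclideanSpace ℝ (Fin n) =>
      (x j - vertex (roundSupport b) j) ^ 2) (multivariateGaussian b S) := by
    refine (hint ((MvPolynomial.X j - MvPolynomial.C (vertex (roundSupport b) j)) ^ 2)).congr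
      (.of_forall fun x => ?_)
    simp only [map_pow, map_sub, MvPolynomial.eval_X, MvPolynomial.eval_C]
  have i2 (j : Fin n) : Integrable (fun x : EuclideanSpace ℝ (Fin n) =>
      (x j ^ 2 - x j) ^ 2) (multivariateGaussian b S) := by
    refine (hint ((MvPolynomial.X j ^ 2 - MvPolynomial.X j) ^ 2)).congr (.of_forall fun x => ?_)
    simp only [map_pow, map_sub, MvPolynomial.eval_X]
  have hm (j : Fin n) := measurePreserving_eval_multivariateGaussian (μ := b)
    hS.posSemidef (i := j)
  have hle : ∫ x, ∑ j, (x j ^ 2 - x j) ^ 2 ∂multivariateGaussian b S ≤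
      ∫ x, MvPolynomial.eval (fun j => x j) (wellPoly n e) ∂multivariateGaussian b S :=
    integral_mono (integrable_finsetSum _ fun j _ => i2 j) (hint _)
      fun x => sum_sq_le_eval_wellPoly e (fun j => x j)
  refine le_trans ?_ (mul_le_mul_of_nonneg_left hle (by norm_num))
  rw [integral_finsetSum _ fun j _ => i1 j, integral_finsetSum _ fun j _ => i2 j, Finset.mul_sum]
  refine Finset.sum_le_sum fun j _ => ?_
  rw [vertex_roundSupport_apply]
  have h := integral_sub_roundBit_sq_le (b j) (S j j).toNNReal
  rwa [← (hm j).map_eq, integral_map (by fun_prop) (by fun_prop),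
    integral_map (by fun_prop) (by fun_prop)] at h

end well

/-! ### Gaussian mixtures as functionals -/

section mixture

variable {n : ℕ}

lemma integrable_eval_gaussianMixture {k : ℕ} (c : Fin k → ℝ≥0)
    (b : Fin k → EuclideanSpace ℝ (Fin n)) (S : Fin k → Matrix (Fin n) (Fin n) ℝ)
    (q : MvPolynomial (Fin n) ℝ) :
    Integrable (fun x => MvPolynomial.eval (fun j => x j) q)
      (∑ i, c i • multivariateGaussian (b i) (S i)) :=
  integrable_finsetSum_measure.2 fun _ _ =>
    (integrable_eval_of_isGaussian _ q).smul_measure_nnreal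

lemma integral_eval_gaussianMixture {k : ℕ} (c : Fin k → ℝ≥0)
    (b : Fin k → EuclideanSpace ℝ (Fin n)) (S : Fin k → Matrix (Fin n) (Fin n) ℝ)
    (q : MvPolynomial (Fin n) ℝ) :
    ∫ x, MvPolynomial.eval (fun j => x j) q ∂(∑ i, c i • multivariateGaussian (b i) (S i)) =
      ∑ i, (c i : ℝ) * ∫ x, MvPolynomial.eval (fun j => x j) q
        ∂multivariateGaussian (b i) (S i) := by
  rw [integral_finsetSum_measure fun i _ =>
    (integrable_eval_of_isGaussian _ q).smul_measure_nnreal]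
  refine Finset.sum_congr rfl fun i _ => ?_
  rw [integral_smul_nnreal_measure]
  rfl

/-- The functional `p ↦ ∫ p dμ` of the Gaussian mixture `μ = ∑ᵢ cᵢ • N(bᵢ, Sᵢ)`. -/
noncomputable def gaussianMixtureFunctional (m : ℕ) {k : ℕ} (c : Fin k → ℝ≥0)
    (b : Fin k → EuclideanSpace ℝ (Fin n)) (S : Fin k → Matrix (Fin n) (Fin n) ℝ) :
    PolyLE n m →ₗ[ℝ] ℝ where
  toFun p := ∫ x, MvPolynomial.eval (fun j => x j) (p : MvPolynomial (Fin n) ℝ)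
    ∂(∑ i, c i • multivariateGaussian (b i) (S i))
  map_add' p q := by
    simp only [Submodule.coe_add, map_add]
    exact integral_add (integrable_eval_gaussianMixture c b S _)
      (integrable_eval_gaussianMixture c b S _)
  map_smul' a p := by
    simp only [Submodule.coe_smul, MvPolynomial.smul_eval, RingHom.id_apply, smul_eq_mul]
    exact integral_const_mul _ _

lemma represents_gaussianMixtureFunctional (m : ℕ) {k : ℕ} (c : Fin k → ℝ≥0)
    (b : Fin k → EuclideanSpace ℝ (Fin n)) (S : Fin k → Matrix (Fin n) (Fin n) ℝ) :
    Represents (∑ i, c i • multivariateGaussian (b i) (S i))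
      (gaussianMixtureFunctional m c b S) :=
  fun p => ⟨integrable_eval_gaussianMixture c b S p, rfl⟩

/-- Integrated form of `exists_abs_eval_le_of_eval_vertex_eq_zero` for a Gaussian distribution whose
mean is closest to the given vertex; the squared distance is absorbed by the multi-well polynomial,
by `integral_sum_sub_vertex_sq_le`. -/
lemma exists_abs_integral_eval_le (e : ℕ) (q : MvPolynomial (Fin n) ℝ)
    (hq : q ∈ MvPolynomial.restrictTotalDegree (Fin n) ℝ (2 * (e + 2))) (s : Finset (Fin n))
    (hs : MvPolynomial.eval (fun j => vertex s j) q = 0) {η : ℝ} (hη : 0 < η) :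
    ∃ C : ℝ, 0 ≤ C ∧ ∀ (b : EuclideanSpace ℝ (Fin n)) (S : Matrix (Fin n) (Fin n) ℝ),
      S.PosDef → roundSupport b = s →
      |∫ x, MvPolynomial.eval (fun j => x j) q ∂multivariateGaussian b S| ≤
        η + C * ∫ x, MvPolynomial.eval (fun j => x j) (wellPoly n e)
          ∂multivariateGaussian b S := by
  obtain ⟨C, hC, hle⟩ := exists_abs_eval_le_of_eval_vertex_eq_zero e q hq s hs hη
  refine ⟨C * 61, by positivity, fun b S hS hb => ?_⟩
  have hint (p : MvPolynomial (Fin n) ℝ) := integrable_eval_of_isGaussian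
    (multivariateGaussian b S) p
  have i1 : Integrable (fun x : EuclideanSpace ℝ (Fin n) =>
      ∑ j, (x j - vertex s j) ^ 2) (multivariateGaussian b S) := by
    refine (hint (∑ j, (MvPolynomial.X j - MvPolynomial.C (vertex s j)) ^ 2)).congr
      (.of_forall fun x => ?_)
    simp only [map_sum, map_pow, map_sub, MvPolynomial.eval_X, MvPolynomial.eval_C]
  have i2 : Integrable (fun x : EuclideanSpace ℝ (Fin n) => C * (∑ j, (x j - vertex s j) ^ 2 +
      MvPolynomial.eval (fun j => x j) (wellPoly n e))) (multivariateGaussian b S) :=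
    (i1.add (hint _)).const_mul C
  have h := integral_sum_sub_vertex_sq_le e b hS
  rw [hb] at h
  calc |∫ x, MvPolynomial.eval (fun j => x j) q ∂multivariateGaussian b S|
      ≤ ∫ x, |MvPolynomial.eval (fun j => x j) q| ∂multivariateGaussian b S :=
        abs_integral_le_integral_abs
    _ ≤ ∫ x, (η + C * (∑ j, (x j - vertex s j) ^ 2 +
          MvPolynomial.eval (fun j => x j) (wellPoly n e))) ∂multivariateGaussian b S :=
        integral_mono (hint q).abs ((integrable_const _).add i2) hle
    _ = η + C * (∫ x, ∑ j, (x j - vertex s j) ^ 2 ∂multivariateGaussian b S +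
          ∫ x, MvPolynomial.eval (fun j => x j) (wellPoly n e) ∂multivariateGaussian b S) := by
        rw [integral_add (integrable_const _) i2, integral_const_mul,
          integral_add i1 (hint (wellPoly n e))]
        simp
    _ ≤ _ := by
        rw [mul_assoc]
        gcongr
        linarith

/-- If a polynomial vanishes at all the vertices in `A`, then its mean for a Gaussian mixture whose
means are all closest to vertices in `A` is controlled by the mean of the multi-well polynomial,
up to an arbitrarily small multiple of the total mass. The constant does not depend on the
mixture. -/
lemma exists_abs_integral_eval_gaussianMixture_le (e : ℕ) (A : Finset (Finset (Fin n)))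
    (q : MvPolynomial (Fin n) ℝ)
    (hq : q ∈ MvPolynomial.restrictTotalDegree (Fin n) ℝ (2 * (e + 2)))
    (hA : ∀ s ∈ A, MvPolynomial.eval (fun j => vertex s j) q = 0) {η : ℝ} (hη : 0 < η) :
    ∃ C : ℝ, ∀ (k : ℕ) (c : Fin k → ℝ≥0) (b : Fin k → EuclideanSpace ℝ (Fin n))
      (S : Fin k → Matrix (Fin n) (Fin n) ℝ), (∀ i, (S i).PosDef) →
      (∀ i, roundSupport (b i) ∈ A) →
      |∫ x, MvPolynomial.eval (fun j => x j) q
          ∂(∑ i, c i • multivariateGaussian (b i) (S i))| ≤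
        η * ∑ i, (c i : ℝ) + C * ∫ x, MvPolynomial.eval (fun j => x j) (wellPoly n e)
          ∂(∑ i, c i • multivariateGaussian (b i) (S i)) := by
  choose! C hC hle using fun s (hs : s ∈ A) => exists_abs_integral_eval_le e q hq s (hA s hs) hη
  refine ⟨∑ s ∈ A, C s, fun k c b S hS hb => ?_⟩
  rw [integral_eval_gaussianMixture, integral_eval_gaussianMixture, Finset.mul_sum,
    Finset.mul_sum, ← Finset.sum_add_distrib]
  refine (Finset.abs_sum_le_sum_abs _ _).trans (Finset.sum_le_sum fun i _ => ?_)
  rw [abs_mul, NNReal.abs_eq]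
  have hP : 0 ≤ ∫ x, MvPolynomial.eval (fun j => x j) (wellPoly n e)
      ∂multivariateGaussian (b i) (S i) :=
    integral_nonneg fun x => eval_wellPoly_nonneg e _
  have h1 : C (roundSupport (b i)) ≤ ∑ s ∈ A, C s :=
    Finset.single_le_sum (fun s hs => hC s hs) (hb i)
  calc (c i : ℝ) * |∫ x, MvPolynomial.eval (fun j => x j) q ∂multivariateGaussian (b i) (S i)|
      ≤ c i * (η + (∑ s ∈ A, C s) * ∫ x, MvPolynomial.eval (fun j => x j) (wellPoly n e)
          ∂multivariateGaussian (b i) (S i)) := by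
        refine mul_le_mul_of_nonneg_left ?_ (c i).2
        refine (hle _ (hb i) (b i) (S i) (hS i) rfl).trans ?_
        gcongr
    _ = _ := by ring

end mixture

/-! ### Separating few vertices of the cube from a generic sum of many -/

section vertices

variable {n N : ℕ}

/-- The linear combination `∑ᵢ aᵢ ∏_{j ∈ Fᵢ} X_j` of squarefree monomials. -/
noncomputable def squarefreePoly (F : Fin N → Finset (Fin n)) (a : Fin N → ℝ) :
    MvPolynomial (Fin n) ℝ :=
  ∑ i, MvPolynomial.C (a i) * ∏ j ∈ F i, MvPolynomial.X j

lemma eval_vertex_squarefreePoly (F : Fin N → Finset (Fin n)) (a : Fin N → ℝ)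
    (s : Finset (Fin n)) :
    MvPolynomial.eval (fun j => vertex s j) (squarefreePoly F a) =
      ∑ i, a i * if F i ⊆ s then 1 else 0 := by
  simp only [squarefreePoly, map_sum, map_mul, map_prod, MvPolynomial.eval_C, MvPolynomial.eval_X,
    vertex_apply]
  refine Finset.sum_congr rfl fun i _ => ?_
  rw [Finset.prod_ite_zero]
  simp [Finset.subset_iff]

lemma squarefreePoly_mem {m : ℕ} {F : Fin N → Finset (Fin n)} (hF : ∀ i, (F i).card = m)
    (a : Fin N → ℝ) :
    squarefreePoly F a ∈ MvPolynomial.restrictTotalDegree (Fin n) ℝ m := by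
  rw [MvPolynomial.mem_restrictTotalDegree]
  refine MvPolynomial.totalDegree_finsetSum_le fun i _ => ?_
  refine (MvPolynomial.totalDegree_mul _ _).trans ?_
  have := MvPolynomial.totalDegree_finsetProd (F i)
    (fun j => (MvPolynomial.X j : MvPolynomial (Fin n) ℝ))
  simpa [hF i] using this

/-- Among subsets of equal size there are no proper inclusions, so the squarefree monomials of
degree `m` are dual to the vertices of weight `m`. -/
lemma eval_vertex_squarefreePoly_self {m : ℕ} {F : Fin N → Finset (Fin n)}
    (hF : ∀ i, (F i).card = m) (hinj : Function.Injective F) (a : Fin N → ℝ) (i : Fin N) :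
    MvPolynomial.eval (fun j => vertex (F i) j) (squarefreePoly F a) = a i := by
  rw [eval_vertex_squarefreePoly, Finset.sum_eq_single i]
  · simp
  · intro l _ hl
    rw [if_neg, mul_zero]
    intro hsub
    exact hl (hinj (Finset.eq_of_subset_of_card_le hsub (by rw [hF, hF])))
  · simp

lemma exists_squarefreePoly_vanishing (F : Fin N → Finset (Fin n)) (A : Finset (Finset (Fin n)))
    (hA : A.card < N) :
    ∃ a : Fin N → ℝ, a ≠ 0 ∧
      ∀ s ∈ A, MvPolynomial.eval (fun j => vertex s j) (squarefreePoly F a) = 0 := by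
  let f : (Fin N → ℝ) →ₗ[ℝ] (A → ℝ) :=
    LinearMap.pi fun s => ∑ i, (if F i ⊆ s then (1 : ℝ) else 0) • LinearMap.proj i
  have hker : LinearMap.ker f ≠ ⊥ := f.ker_ne_bot_of_finrank_lt (by simpa using hA)
  obtain ⟨a, ha, ha0⟩ := (Submodule.ne_bot_iff _).1 hker
  refine ⟨a, ha0, fun s hs => ?_⟩
  have := congrFun (LinearMap.mem_ker.1 ha) ⟨s, hs⟩
  rw [eval_vertex_squarefreePoly]
  simpa only [f, LinearMap.pi_apply, LinearMap.sum_apply, LinearMap.smul_apply,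
    LinearMap.proj_apply, smul_eq_mul, Pi.zero_apply, mul_comm] using this

/-- Finitely many nonzero linear forms have a common nonzero on the moment curve `(t ^ i)ᵢ` with
`t > 0`, hence at a vector with nonnegative entries. -/
lemma exists_nnreal_forall_sum_mul_ne_zero {ι : Type*} [Finite ι] (a : ι → Fin N → ℝ)
    (ha : ∀ A, a A ≠ 0) : ∃ w : Fin N → ℝ≥0, ∀ A, ∑ i, (w i : ℝ) * a A i ≠ 0 := by
  let p : ι → Polynomial ℝ := fun A => ∑ i : Fin N, Polynomial.C (a A i) * Polynomial.X ^ (i : ℕ)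
  have hp : ∀ A, p A ≠ 0 := fun A h => ha A <| funext fun i => by
    have := congrArg (fun q => Polynomial.coeff q (i : ℕ)) h
    simpa [p, Polynomial.finsetSum_coeff, Polynomial.coeff_C_mul, Polynomial.coeff_X_pow,
      Fin.val_inj] using this
  have hfin : (⋃ A, {t : ℝ | (p A).IsRoot t}).Finite :=
    Set.finite_iUnion fun A => Polynomial.finite_setOfPred_isRoot (hp A)
  obtain ⟨t, ht, htr⟩ := ((Set.Ioi_infinite (0 : ℝ)).sdiff hfin).nonempty
  refine ⟨fun i => t.toNNReal ^ (i : ℕ), fun A h => htr ?_⟩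
  refine Set.mem_iUnion.2 ⟨A, ?_⟩
  simpa only [p, Set.mem_ofPred_eq, Polynomial.IsRoot.def, Polynomial.eval_finsetSum,
    Polynomial.eval_mul, Polynomial.eval_C, Polynomial.eval_pow, Polynomial.eval_X,
    NNReal.coe_pow, Real.coe_toNNReal t (le_of_lt ht), mul_comm] using h

end vertices

/-! ### A mixture of concentrated Gaussian distributions needs all its components -/

/-- For `N` vertices of weight `2 * (e + 2)`, suitable weights and a small enough variance, the
mixture of isotropic Gaussian distributions around these vertices is not a mixture of fewer
than `N` Gaussian distributions. -/
lemma exists_isLeast_isGaussianMixture {n N : ℕ} (e : ℕ) (F : Fin N → Finset (Fin n))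
    (hF : ∀ i, (F i).card = 2 * (e + 2)) (hinj : Function.Injective F) :
    ∃ L : PolyLE n (2 * (e + 2)) →ₗ[ℝ] ℝ, IsMomentFunctional L ∧
      IsLeast {k : ℕ | IsGaussianMixture L k} N := by
  choose! a ha0 ha using exists_squarefreePoly_vanishing (n := n) F
  obtain ⟨w, hw⟩ := exists_nnreal_forall_sum_mul_ne_zero
    (fun A : {A : Finset (Finset (Fin n)) // A.card < N} => a A) fun A => ha0 A A.2
  let S : ℝ → Fin N → Matrix (Fin n) (Fin n) ℝ := fun r _ => r ^ 2 • 1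
  let μ : ℝ → Measure (EuclideanSpace ℝ (Fin n)) := fun r =>
    ∑ i, w i • multivariateGaussian (vertex (F i)) (S r i)
  have hlim (q : MvPolynomial (Fin n) ℝ) :
      Filter.Tendsto (fun r => ∫ x, MvPolynomial.eval (fun j => x j) q ∂μ r)
        (nhdsWithin 0 (Set.Ioi 0))
        (nhds (∑ i, (w i : ℝ) * MvPolynomial.eval (fun j => vertex (F i) j) q)) := by
    simp only [μ, integral_eval_gaussianMixture]
    exact tendsto_finsetSum _ fun i _ =>
      (tendsto_integral_eval_multivariateGaussian (vertex (F i)) q).const_mul _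
  have hmass {k : ℕ} (c : Fin k → ℝ≥0) (b : Fin k → EuclideanSpace ℝ (Fin n))
      (T : Fin k → Matrix (Fin n) (Fin n) ℝ) :
      ∫ x, MvPolynomial.eval (fun j => x j) (1 : MvPolynomial (Fin n) ℝ)
        ∂(∑ i, c i • multivariateGaussian (b i) (T i)) = ∑ i, (c i : ℝ) := by
    rw [integral_eval_gaussianMixture]
    simp
  -- For a fixed set `A` of fewer than `N` vertices, a mixture whose means all round into `A` cannot
  -- have the same moments as `μ r` for small `r`, since the polynomial attached to `A`
  -- has a small mean for the former and a mean bounded away from `0` for the latter.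
  have hA (A : Finset (Finset (Fin n))) (hAN : A.card < N) :
      ∀ᶠ r in nhdsWithin (0 : ℝ) (Set.Ioi 0), ∀ (k : ℕ) (c : Fin k → ℝ≥0)
        (b : Fin k → EuclideanSpace ℝ (Fin n)) (T : Fin k → Matrix (Fin n) (Fin n) ℝ),
        (∀ i, (T i).PosDef) → (∀ i, roundSupport (b i) ∈ A) →
        ¬ Represents (∑ i, c i • multivariateGaussian (b i) (T i))
          (gaussianMixtureFunctional (2 * (e + 2)) w (fun i => vertex (F i)) (S r)) := by
    set q := squarefreePoly F (a A) with hq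
    have hqmem := squarefreePoly_mem hF (a A)
    set W : ℝ := ∑ i, (w i : ℝ) with hW
    have hW0 : 0 ≤ W := Finset.sum_nonneg fun i _ => (w i).2
    set κ : ℝ := |∑ i, (w i : ℝ) * MvPolynomial.eval (fun j => vertex (F i) j) q| with hκ
    have hκ0 : 0 < κ := by
      simp only [hκ, hq, eval_vertex_squarefreePoly_self hF hinj]
      exact abs_pos.2 (hw ⟨A, hAN⟩)
    obtain ⟨C, hC⟩ := exists_abs_integral_eval_gaussianMixture_le e A q hqmem
      (fun s hs => ha A hAN s hs) (η := κ / (2 * (W + 1))) (by positivity)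
    have l1 := (hlim q).abs
    have l2 := ((hlim (wellPoly n e)).const_mul C).const_add (κ / (2 * (W + 1)) * W)
    simp only [eval_wellPoly_vertex, mul_zero, Finset.sum_const_zero, add_zero] at l2
    have hlt : κ / (2 * (W + 1)) * W < κ := by
      rw [div_mul_eq_mul_div, div_lt_iff₀ (by positivity)]
      nlinarith
    filter_upwards [l2.eventually_lt l1 hlt] with r hr k c b T hT hb hrep
    have hLq := (hrep ⟨q, hqmem⟩).2
    have hLP := (hrep ⟨wellPoly n e, wellPoly_mem n e⟩).2
    have hL1 := (hrep ⟨1, by rw [MvPolynomial.mem_restrictTotalDegree]; simp⟩).2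
    simp only [gaussianMixtureFunctional, LinearMap.coe_mk, AddHom.coe_mk] at hLq hLP hL1
    rw [hmass, hmass] at hL1
    have := hC k c b T hT hb
    rw [← hLq, ← hLP, ← hL1] at this
    exact absurd hr (not_lt.2 this)
  have hall : ∀ᶠ r in nhdsWithin (0 : ℝ) (Set.Ioi 0),
      ∀ A : {A : Finset (Finset (Fin n)) // A.card < N}, ∀ (k : ℕ) (c : Fin k → ℝ≥0)
        (b : Fin k → EuclideanSpace ℝ (Fin n)) (T : Fin k → Matrix (Fin n) (Fin n) ℝ),
        (∀ i, (T i).PosDef) → (∀ i, roundSupport (b i) ∈ A.1) →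
        ¬ Represents (∑ i, c i • multivariateGaussian (b i) (T i))
          (gaussianMixtureFunctional (2 * (e + 2)) w (fun i => vertex (F i)) (S r)) :=
    Filter.eventually_all.2 fun A => hA A.1 A.2
  obtain ⟨r, hr, hr0⟩ := (hall.and self_mem_nhdsWithin).exists
  have hrep := represents_gaussianMixtureFunctional (2 * (e + 2)) w (fun i => vertex (F i)) (S r)
  refine ⟨_, ⟨_, hrep⟩, ⟨w, _, S r, fun i => ?_, hrep⟩, ?_⟩
  · exact Matrix.PosDef.one.smul (pow_pos hr0 2)
  · rintro k ⟨c, b, T, hT, hL⟩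
    by_contra! hk
    have hcard : (Finset.univ.image fun i => roundSupport (b i)).card < N :=
      (Finset.card_image_le.trans (by simp)).trans_lt hk
    exact hr ⟨_, hcard⟩ k c b T hT
      (fun i => Finset.mem_image_of_mem _ (Finset.mem_univ i)) hL

/-! ### Almost all monomials of bounded degree are squarefree of top degree -/

lemma exists_one_sub_mul_choose_le (m : ℕ) (ε : ℝ) (hε : 0 < ε) :
    ∃ n : ℕ, 1 ≤ n ∧ (1 - ε) * ((m + n).choose n : ℝ) ≤ n.choose m := by
  obtain ⟨k, hk⟩ := exists_nat_gt ((m * (2 * m) : ℝ) / ε)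
  refine ⟨k + m + 1, by omega, ?_⟩
  set n := k + m + 1 with hn
  have hnk : (k : ℝ) ≤ m + n := by rw [hn]; push_cast; linarith [Nat.cast_nonneg (α := ℝ) m]
  have hpos : (0 : ℝ) < m + n := by rw [hn]; push_cast; positivity
  have hmn : (m : ℝ) ≤ n := by rw [hn]; push_cast; linarith [Nat.cast_nonneg (α := ℝ) k]
  have hfac : (0 : ℝ) < m.factorial := by positivity
  have h1 : ((m + n).choose n : ℝ) * m.factorial ≤ (m + n : ℝ) ^ m := by
    have h := Nat.descFactorial_le_pow (m + n) m
    rw [Nat.descFactorial_eq_factorial_mul_choose, mul_comm] at h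
    rw [← Nat.choose_symm_add]
    exact_mod_cast h
  have h2 : ((n : ℝ) - m) ^ m ≤ (n.choose m : ℝ) * m.factorial := by
    have h := Nat.pow_sub_le_descFactorial n m
    rw [Nat.descFactorial_eq_factorial_mul_choose, mul_comm] at h
    have h' : ((n + 1 - m : ℕ) : ℝ) ^ m ≤ (n.choose m : ℝ) * m.factorial := by exact_mod_cast h
    refine le_trans (pow_le_pow_left₀ (by linarith) ?_ m) h'
    rw [Nat.cast_sub (by omega)]
    push_cast
    linarith
  -- Bernoulli's inequality for `(n - m) / (n + m) = 1 - 2 m / (n + m)`.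
  have h3 : (1 - ε) * (m + n : ℝ) ^ m ≤ ((n : ℝ) - m) ^ m := by
    set y : ℝ := 2 * m / (m + n) with hy
    have hy1 : y ≤ 1 := by rw [hy, div_le_one hpos]; linarith
    have hb := one_add_mul_le_pow (a := -y) (by linarith) m
    have hmy : m * y ≤ ε := by
      rw [hy, ← mul_div_assoc, div_le_iff₀ hpos]
      have := (div_lt_iff₀ hε).1 hk
      nlinarith
    have he : (n : ℝ) - m = (1 + -y) * (m + n) := by rw [hy]; field_simp; ring
    rw [he, mul_pow]
    refine mul_le_mul_of_nonneg_right ?_ (by positivity)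
    linarith
  rcases le_total 0 (1 - ε) with h0 | h0
  · refine le_of_mul_le_mul_right ?_ hfac
    calc (1 - ε) * ((m + n).choose n : ℝ) * m.factorial
        = (1 - ε) * (((m + n).choose n : ℝ) * m.factorial) := by ring
      _ ≤ (1 - ε) * (m + n : ℝ) ^ m := mul_le_mul_of_nonneg_left h1 h0
      _ ≤ _ := h3.trans h2
  · exact (mul_nonpos_of_nonpos_of_nonneg h0 (by positivity)).trans (by positivity)

theorem mainTheorem2 (d : ℕ) (hd : 2 ≤ d) (ε : ℝ) (hε : 0 < ε) :
    ∃ n : ℕ, 1 ≤ n ∧ ∃ L : PolyLE n (2 * d) →ₗ[ℝ] ℝ,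
      IsMomentFunctional L ∧
      IsLeast {k : ℕ | IsGaussianMixture L k} ⌈(1 - ε) * ((2 * d + n).choose n : ℝ)⌉₊ := by
  obtain ⟨e, rfl⟩ : ∃ e, d = e + 2 := ⟨d - 2, by omega⟩
  obtain ⟨n, hn, hle⟩ := exists_one_sub_mul_choose_le (2 * (e + 2)) ε hε
  refine ⟨n, hn, ?_⟩
  have hN := Nat.ceil_le.2 hle
  generalize ⌈(1 - ε) * ((2 * (e + 2) + n).choose n : ℝ)⌉₊ = N at hN
  obtain ⟨U, hU, hUN⟩ := Finset.exists_subset_card_eq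
    (s := Finset.powersetCard (2 * (e + 2)) (Finset.univ : Finset (Fin n))) (n := N) (by simpa)
  let F := U.equivFinOfCardEq hUN
  exact exists_isLeast_isGaussianMixture e (fun i => (F.symm i : Finset (Fin n)))
    (fun i => (Finset.mem_powersetCard.1 (hU (F.symm i).2)).2)
    (Subtype.val_injective.comp F.symm.injective)
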